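/- Let $f\in\mathcal C^1(\mathbb R;\mathbb R)$, put $F(\rho)=\int_\rho^1 f(r)\,dr$, and assume that there is $\lambda>0$ with $F(\rho)\ge\lambda(1-\rho)^2$ for all $\rho\ge 0$. For $v\in H^1_{\mathrm{loc}}(\mathbb R;\mathbb C)$ (identified with its continuous representative) let $$E(v)=\frac12\int_{\mathbb R}|v'|^2\,dx+\frac12\int_{\mathbb R}F(|v|^2)\,dx\in[0,+\infty].$$ Call $\mathfrak v_0\in\mathcal C^2(\mathbb R;\mathbb C)$ a kink if it is a non-constant solution of $\mathfrak v_0''+\mathfrak v_0f(|\mathfrak v_0|^2)=0$ on $\mathbb R$ with $|\mathfrak v_0(x)|\to1$ as $|x|\to\infty$. Then a kink exists, and it is unique up to translations and multiplication by a constant of modulus one. Every kink $\mathfrak v_0$ belongs to $H^1_{\mathrm{loc}}(\mathbb R)$, has finite energy, vanishes at some point, and satisfies $$E(\mathfrak v_0)=\inf\Big\{E(v)\ \Big|\ v\in H^1_{\mathrm{loc}}(\mathbb R),\ \inf_{\mathbb R}|v|=0\Big\};$$ thus $\mathfrak v_0$ minimizes $E$ among all $v\in H^1_{\mathrm{loc}}(\mathbb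 R)$ that vanish somewhere. In particular, if $v\in H^1_{\mathrm{loc}}(\mathbb R)$ and $E(v)<E(\mathfrak v_0)$, then $\inf_{\mathbb R}|v|>0$. -/

import Mathlib

open MeasureTheory Filter Topology
open scoped ENNReal ContDiff

namespace NLSKink

/-- `g` is a weak derivative of `v : ℝ → ℂ`: both are locally integrable and
`∫ φ' v = - ∫ φ g` for all smooth compactly supported test functions `φ`. -/
def HasWeakDeriv (v g : ℝ → ℂ) : Prop :=
  LocallyIntegrable v ∧ LocallyIntegrable g ∧
    ∀ φ : ℝ → ℝ, ContDiff ℝ ∞ φ → HasCompactSupport φ →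
      ∫ x, deriv φ x • v x = -∫ x, φ x • g x

/-- `v` is square integrable on all compact sets. -/
def MemL2loc (v : ℝ → ℂ) : Prop :=
  ∀ K : Set ℝ, IsCompact K → MemLp v 2 (volume.restrict K)

/-- The (continuous representatives of the) elements of `H¹_loc(ℝ; ℂ)`: continuous functions in
`L²_loc` that have a weak derivative in `L²_loc`. In one space dimension each class in `H¹_loc`
has exactly one continuous representative, and pointwise values refer to it. -/
def MemH1loc (v : ℝ → ℂ) : Prop :=
  Continuous v ∧ MemL2loc v ∧ ∃ g : ℝ → ℂ, HasWeakDeriv v g ∧ MemL2loc g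

open Classical in
/-- The weak derivative of `v` (unique up to a null set), when there is one. -/
noncomputable def weakDeriv (v : ℝ → ℂ) : ℝ → ℂ :=
  if h : ∃ g : ℝ → ℂ, HasWeakDeriv v g then h.choose else 0

/-- `F(ρ) = ∫_ρ^1 f(r) dr`. -/
noncomputable def potential (f : ℝ → ℝ) (ρ : ℝ) : ℝ := ∫ r in ρ..1, f r

/-- The Ginzburg-Landau energy `E(v) = 1/2 ∫ |v'|² + 1/2 ∫ F(|v|²)`, with values in `[0, ∞]`,
for a nonlinearity with `F ≥ 0` on `[0, ∞)`. -/
noncomputable def energy (f : ℝ → ℝ) (v : ℝ → ℂ) : ℝ≥0∞ :=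
  (1 / 2) * (∫⁻ x, ENNReal.ofReal (‖weakDeriv v x‖ ^ 2)) +
    (1 / 2) * ∫⁻ x, ENNReal.ofReal (potential f (‖v x‖ ^ 2))

/-- `u` is a (classical) solution of the profile equation `i c u' + u'' + u f(|u|²) = 0` of
travelling waves of speed `c`. -/
def IsTravellingWave (f : ℝ → ℝ) (c : ℝ) (u : ℝ → ℂ) : Prop :=
  ContDiff ℝ 2 u ∧
    ∀ x, Complex.I * c * deriv u x + deriv (deriv u) x + u x * (f (‖u x‖ ^ 2) : ℂ) = 0

/-- A kink: a non-constant stationary solution (speed `0`) whose modulus tends to `1` as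
`|x| → ∞`. -/
def IsKink (f : ℝ → ℝ) (u : ℝ → ℂ) : Prop :=
  IsTravellingWave f 0 u ∧ (¬ ∃ z : ℂ, ∀ x, u x = z) ∧
    Tendsto (fun x => ‖u x‖) (cocompact ℝ) (𝓝 1)

end NLSKink

namespace NLSKink

/-! ### The potential -/

/-! The profile equation conserves `|u'|² - F(|u|²)` and `Im (ū u')`. For a kink both constants are
zero (`kink_first_integrals`), so away from its zeros a kink has no critical point of the modulus.
Unless `|u|` equals 1 somewhere, which would make `u` constant, `|u|` attains an extremum because it
tends to 1; hence `u` vanishes there (`kink_exists_zero`). At a zero `|u'|² = F(0)`, so the Cauchy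
data of two kinks at their zeros differ only by a phase, and ODE uniqueness gives `kink_unique`.
Existence follows by separating variables in `w' = √F(w²)` (`exists_real_kink`).

Minimality is the Modica–Mortola trick. With `action f s = ∫₀ˢ √F(t²) dt`, `½|v'|² + ½F(|v|²) ≥
√F(|v|²) |v'|`, and the right side controls the increments of `action f |v|`
(`ofReal_abs_action_sub_le`). If `inf |v| = 0` and the energy is finite, then `|v|` passes from near
1 to near 0 and back to near 1, which costs at least `2 * action f 1` (`ofReal_le_energy`). For a
kink `|u'|² = F(|u|²)`, and its energy is exactly this number (`energy_kink`). -/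

theorem potential_one (f : ℝ → ℝ) : potential f 1 = 0 := by simp [potential]

theorem hasDerivAt_potential {f : ℝ → ℝ} (hf : Continuous f) (ρ : ℝ) :
    HasDerivAt (potential f) (-f ρ) ρ :=
  intervalIntegral.integral_hasDerivAt_left (hf.intervalIntegrable _ _)
    hf.stronglyMeasurable.stronglyMeasurableAtFilter hf.continuousAt

theorem continuous_potential {f : ℝ → ℝ} (hf : Continuous f) : Continuous (potential f) :=
  continuous_iff_continuousAt.2 fun ρ => (hasDerivAt_potential hf ρ).continuousAt

/-- The lower bound on the potential that is assumed throughout. -/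
def Coercive (f : ℝ → ℝ) : Prop :=
  ∃ l : ℝ, 0 < l ∧ ∀ ρ : ℝ, 0 ≤ ρ → l * (1 - ρ) ^ 2 ≤ potential f ρ

theorem Coercive.potential_nonneg {f : ℝ → ℝ} (hF : Coercive f) {ρ : ℝ} (hρ : 0 ≤ ρ) :
    0 ≤ potential f ρ := by
  obtain ⟨l, hl, h⟩ := hF
  exact le_trans (by positivity) (h ρ hρ)

theorem Coercive.potential_pos {f : ℝ → ℝ} (hF : Coercive f) {ρ : ℝ} (hρ : 0 ≤ ρ) (h1 : ρ ≠ 1) :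
    0 < potential f ρ := by
  obtain ⟨l, hl, h⟩ := hF
  have : 0 < (1 - ρ) ^ 2 := by
    have := sub_ne_zero.2 h1.symm
    positivity
  exact lt_of_lt_of_le (by positivity) (h ρ hρ)

/-- The potential is nonnegative on `[0, ∞)` and zero at 1, so 1 is an interior minimum and the
derivative `-f 1` vanishes. -/
theorem Coercive.apply_one {f : ℝ → ℝ} (hf : Continuous f) (hF : Coercive f) : f 1 = 0 := by
  have hmin : IsLocalMin (potential f) 1 := by
    filter_upwards [lt_mem_nhds (zero_lt_one' ℝ)] with ρ hρ
    rw [potential_one]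
    exact hF.potential_nonneg hρ.le
  simpa using hmin.hasDerivAt_eq_zero (hasDerivAt_potential hf 1)

/-- The potential vanishes at least quadratically at `1`. -/
theorem Coercive.exists_potential_le {f : ℝ → ℝ} (hf : ContDiff ℝ 1 f) (hF : Coercive f) :
    ∃ L : ℝ, 0 < L ∧ ∀ ρ ∈ Set.Icc (0 : ℝ) 1, potential f ρ ≤ L * (1 - ρ) ^ 2 := by
  obtain ⟨K, hK⟩ := (hf.contDiffOn (s := Set.Icc (0 : ℝ) 1)).exists_lipschitzOnWith one_ne_zero
    (convex_Icc 0 1) isCompact_Icc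
  refine ⟨K + 1, by positivity, fun ρ hρ => ?_⟩
  -- Since `f 1 = 0`, the Lipschitz bound makes `f` of order `1 - ρ` on `[ρ, 1]`; integrating gains
  -- the second factor. The extra 1 in `K + 1` only makes the constant positive.
  have hb : ∀ r ∈ Set.uIoc ρ 1, ‖f r‖ ≤ (K + 1) * (1 - ρ) := by
    intro r hr
    rw [Set.uIoc_of_le hρ.2] at hr
    have h := hK.dist_le_mul r ⟨hρ.1.trans hr.1.le, hr.2⟩ 1 (by simp)
    rw [Real.dist_eq, Real.dist_eq, hF.apply_one hf.continuous, sub_zero, abs_sub_comm,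
      abs_of_nonneg (sub_nonneg.2 hr.2)] at h
    rw [Real.norm_eq_abs]
    nlinarith [hr.1, hr.2, K.coe_nonneg]
  have h := intervalIntegral.norm_integral_le_of_norm_le_const hb
  rw [abs_of_nonneg (sub_nonneg.2 hρ.2)] at h
  calc potential f ρ ≤ ‖∫ r in ρ..1, f r‖ := Real.le_norm_self _
    _ ≤ _ := h
    _ = _ := by ring

/-! ### Uniqueness for the profile equation -/

/-- The first order system equivalent to `u'' + u f(|u|²) = 0`. -/
noncomputable def profileField (f : ℝ → ℝ) (z : ℂ × ℂ) : ℂ × ℂ := (z.2, -(z.1 * (f (‖z.1‖ ^ 2) : ℂ)))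

theorem contDiff_profileField {f : ℝ → ℝ} (hf : ContDiff ℝ 1 f) : ContDiff ℝ 1 (profileField f) :=
  contDiff_snd.prodMk (contDiff_fst.mul
    (Complex.ofRealCLM.contDiff.comp (hf.comp (contDiff_fst.norm_sq ℝ)))).neg

/-- The field is only locally Lipschitz, so both trajectories over a bounded interval containing
`t₀` and `t` are confined to a common ball, on which a `C¹` field is Lipschitz. -/
theorem profileField_unique {f : ℝ → ℝ} (hf : ContDiff ℝ 1 f) {Y Z : ℝ → ℂ × ℂ}
    (hY : ∀ t, HasDerivAt Y (profileField f (Y t)) t)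
    (hZ : ∀ t, HasDerivAt Z (profileField f (Z t)) t) {t₀ : ℝ} (h0 : Y t₀ = Z t₀) : Y = Z := by
  funext t
  obtain ⟨a, b, ht₀, ht⟩ : ∃ a b, t₀ ∈ Set.Ioo a b ∧ t ∈ Set.Ioo a b :=
    ⟨min t₀ t - 1, max t₀ t + 1, by constructor <;> grind, by constructor <;> grind⟩
  have cY : Continuous Y := continuous_iff_continuousAt.2 fun t => (hY t).continuousAt
  have cZ : Continuous Z := continuous_iff_continuousAt.2 fun t => (hZ t).continuousAt
  obtain ⟨R, hR⟩ := ((isCompact_Icc (a := a) (b := b)).image cY).isBounded.subset_closedBall 0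
  obtain ⟨S, hS⟩ := ((isCompact_Icc (a := a) (b := b)).image cZ).isBounded.subset_closedBall 0
  obtain ⟨K, hK⟩ := ((contDiff_profileField hf).contDiffOn
    (s := Metric.closedBall 0 (max R S))).exists_lipschitzOnWith one_ne_zero
    (convex_closedBall _ _) (isCompact_closedBall _ _)
  refine ODE_solution_unique_of_mem_Ioo (v := fun _ => profileField f)
    (s := fun _ => Metric.closedBall 0 (max R S)) (fun _ _ => hK) ht₀
    (fun s hs => ⟨hY s, ?_⟩) (fun s hs => ⟨hZ s, ?_⟩) h0 ht
  · exact Metric.closedBall_subset_closedBall (le_max_left _ _)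
      (hR ⟨s, Set.Ioo_subset_Icc_self hs, rfl⟩)
  · exact Metric.closedBall_subset_closedBall (le_max_right _ _)
      (hS ⟨s, Set.Ioo_subset_Icc_self hs, rfl⟩)

theorem isTravellingWave_zero_iff {f : ℝ → ℝ} (hf : Continuous f) {u : ℝ → ℂ} :
    IsTravellingWave f 0 u ↔ ∃ u' : ℝ → ℂ, (∀ x, HasDerivAt u (u' x) x) ∧
      ∀ x, HasDerivAt u' (-(u x * (f (‖u x‖ ^ 2) : ℂ))) x := by
  constructor
  · rintro ⟨h2, h⟩
    have h1 : ContDiff ℝ 1 (deriv u) := by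
      rw [show (2 : WithTop ℕ∞) = 1 + 1 from rfl, contDiff_succ_iff_deriv] at h2
      exact h2.2.2
    refine ⟨deriv u, fun x => (h2.differentiable two_ne_zero x).hasDerivAt, fun x => ?_⟩
    refine (h1.differentiable one_ne_zero x).hasDerivAt.congr_deriv ?_
    have := h x
    simp only [Complex.ofReal_zero, mul_zero, zero_mul, zero_add] at this
    linear_combination this
  · rintro ⟨u', hu, hu'⟩
    have e : deriv u = u' := funext fun x => (hu x).deriv
    have cu : Continuous u := continuous_iff_continuousAt.2 fun x => (hu x).continuousAt
    refine ⟨?_, fun x => by rw [e, (hu' x).deriv]; simp⟩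
    rw [show (2 : WithTop ℕ∞) = 1 + 1 from rfl, contDiff_succ_iff_deriv, e]
    refine ⟨fun x => (hu x).differentiableAt, by simp, ?_⟩
    rw [contDiff_one_iff_deriv]
    refine ⟨fun x => (hu' x).differentiableAt, ?_⟩
    rw [funext fun x => (hu' x).deriv]
    fun_prop

theorem profile_unique {f : ℝ → ℝ} (hf : ContDiff ℝ 1 f) {u u' w w' : ℝ → ℂ}
    (hu : ∀ x, HasDerivAt u (u' x) x)
    (hu' : ∀ x, HasDerivAt u' (-(u x * (f (‖u x‖ ^ 2) : ℂ))) x)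
    (hw : ∀ x, HasDerivAt w (w' x) x)
    (hw' : ∀ x, HasDerivAt w' (-(w x * (f (‖w x‖ ^ 2) : ℂ))) x) {x₀ : ℝ}
    (h0 : u x₀ = w x₀) (h1 : u' x₀ = w' x₀) : u = w := by
  have := profileField_unique hf (Y := fun x => (u x, u' x)) (Z := fun x => (w x, w' x))
    (fun t => (hu t).prodMk (hu' t)) (fun t => (hw t).prodMk (hw' t)) (t₀ := x₀) (by simp [h0, h1])
  funext x
  exact congrArg Prod.fst (congrFun this x)

/-! ### Structure of kinks -/

/-- A derivative eventually above `C / 2` forces linear growth. This will exclude a positive energy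
constant for kinks. -/
theorem not_bddAbove_of_tendsto_deriv_pos {k k' : ℝ → ℝ} {C B : ℝ}
    (hk : ∀ x, HasDerivAt k (k' x) x) (hC : 0 < C) (hk' : Tendsto k' atTop (𝓝 C)) :
    ¬ ∀ᶠ x in atTop, k x ≤ B := by
  intro hB
  obtain ⟨N, hN⟩ := eventually_atTop.1 ((hk'.eventually_const_lt (half_lt_self hC)).and hB)
  have h : ∀ x, N ≤ x → C / 2 * (x - N) ≤ k x - k N := fun x hx =>
    (convex_Ici N).mul_sub_le_image_sub_of_le_deriv
      (fun y _ => (hk y).continuousAt.continuousWithinAt)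
      (fun y _ => (hk y).differentiableAt.differentiableWithinAt)
      (fun y hy => by
        rw [(hk y).deriv]
        exact (hN y (interior_subset hy)).1.le) N (by simp) x hx hx
  set T := 2 * (|B - k N| + 1) / C with hT
  have hT0 : 0 ≤ T := by positivity
  have h1 := h (N + T) (by linarith)
  have h2 := (hN (N + T) (by linarith)).2
  have h3 : C / 2 * (N + T - N) = |B - k N| + 1 := by rw [hT]; field_simp; ring
  have h4 := le_abs_self (B - k N)
  linarith

theorem sq_norm_eq_re_im (z : ℂ) : ‖z‖ ^ 2 = z.re ^ 2 + z.im ^ 2 := by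
  rw [Complex.sq_norm, Complex.normSq_apply]; ring

theorem hasDerivAt_re {g : ℝ → ℂ} {g' : ℂ} {x : ℝ} (h : HasDerivAt g g' x) :
    HasDerivAt (fun y => (g y).re) g'.re x :=
  Complex.reCLM.hasFDerivAt.comp_hasDerivAt _ h

theorem hasDerivAt_im {g : ℝ → ℂ} {g' : ℂ} {x : ℝ} (h : HasDerivAt g g' x) :
    HasDerivAt (fun y => (g y).im) g'.im x :=
  Complex.imCLM.hasFDerivAt.comp_hasDerivAt _ h

theorem hasDerivAt_sq_norm {g : ℝ → ℂ} {g' : ℂ} {x : ℝ} (h : HasDerivAt g g' x) :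
    HasDerivAt (fun y => ‖g y‖ ^ 2) (2 * ((g x).re * g'.re + (g x).im * g'.im)) x := by
  simp only [sq_norm_eq_re_im]
  refine (((hasDerivAt_re h).pow 2).add ((hasDerivAt_im h).pow 2)).congr_deriv ?_
  push_cast; ring

/-- Every kink is at rest at infinity: `|u'|² = F(|u|²)`, `Im (u̅ u') = 0`. -/
theorem kink_first_integrals {f : ℝ → ℝ} (hf : ContDiff ℝ 1 f) (hF : Coercive f) {u u' : ℝ → ℂ}
    (hu : ∀ x, HasDerivAt u (u' x) x)
    (hu' : ∀ x, HasDerivAt u' (-(u x * (f (‖u x‖ ^ 2) : ℂ))) x)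
    (hlim : Tendsto (fun x => ‖u x‖) (cocompact ℝ) (𝓝 1)) :
    (∀ x, ‖u' x‖ ^ 2 = potential f (‖u x‖ ^ 2)) ∧
      ∀ x, (u x).re * (u' x).im - (u x).im * (u' x).re = 0 := by
  have hE : ∀ x, HasDerivAt (fun y => ‖u' y‖ ^ 2 - potential f (‖u y‖ ^ 2)) 0 x := fun x => by
    have h1 := hasDerivAt_sq_norm (hu' x)
    have h2 := (hasDerivAt_potential hf.continuous (‖u x‖ ^ 2)).comp x (hasDerivAt_sq_norm (hu x))
    have h3 := h1.sub h2
    refine h3.congr_deriv ?_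
    simp
    ring
  have hJ : ∀ x, HasDerivAt (fun y => (u y).re * (u' y).im - (u y).im * (u' y).re) 0 x :=
    fun x => by
    refine (((hasDerivAt_re (hu x)).mul (hasDerivAt_im (hu' x))).sub
      ((hasDerivAt_im (hu x)).mul (hasDerivAt_re (hu' x)))).congr_deriv ?_
    simp
    ring
  have const : ∀ {g : ℝ → ℝ}, (∀ x, HasDerivAt g 0 x) → ∀ x y, g x = g y := fun h =>
    is_const_of_deriv_eq_zero (fun x => (h x).differentiableAt) (fun x => (h x).deriv)
  have hlim' : Tendsto (fun x => ‖u x‖) atTop (𝓝 1) := hlim.mono_left atTop_le_cocompact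
  have hlim2 : Tendsto (fun x => ‖u x‖ ^ 2) atTop (𝓝 1) := by simpa using hlim'.pow 2
  have hP : Tendsto (fun x => potential f (‖u x‖ ^ 2)) atTop (𝓝 0) := by
    have := ((continuous_potential hf.continuous).tendsto 1).comp hlim2
    rwa [potential_one] at this
  have hfl : Tendsto (fun x => f (‖u x‖ ^ 2)) atTop (𝓝 0) := by
    have := (hf.continuous.tendsto 1).comp hlim2
    rwa [hF.apply_one hf.continuous] at this
  set C := ‖u' 0‖ ^ 2 - potential f (‖u 0‖ ^ 2) with hC
  have hEC : ∀ x, ‖u' x‖ ^ 2 = potential f (‖u x‖ ^ 2) + C := fun x => by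
    have := const hE x 0
    linarith
  have hu'C : Tendsto (fun x => ‖u' x‖ ^ 2) atTop (𝓝 C) := by
    simpa [hEC] using hP.add_const C
  have hC0 : 0 ≤ C := ge_of_tendsto' hu'C fun x => by positivity
  -- The derivative of `Re (ū u')` tends to `C`, because `f (|u|²)` tends to `f 1 = 0`. But `Re (ū
  -- u')` stays bounded, so `C` cannot be positive.
  have hk : ∀ x, HasDerivAt (fun y => (u y).re * (u' y).re + (u y).im * (u' y).im)
      (‖u' x‖ ^ 2 - ‖u x‖ ^ 2 * f (‖u x‖ ^ 2)) x := fun x => by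
    refine (((hasDerivAt_re (hu x)).mul (hasDerivAt_re (hu' x))).add
      ((hasDerivAt_im (hu x)).mul (hasDerivAt_im (hu' x)))).congr_deriv ?_
    rw [sq_norm_eq_re_im (u' x)]
    have := sq_norm_eq_re_im (u x)
    simp only [Complex.neg_re, Complex.neg_im, Complex.re_mul_ofReal, Complex.im_mul_ofReal]
    linear_combination f (‖u x‖ ^ 2) * this
  have hkl : Tendsto (fun x => ‖u' x‖ ^ 2 - ‖u x‖ ^ 2 * f (‖u x‖ ^ 2)) atTop (𝓝 C) := by
    simpa using hu'C.sub (hlim2.mul hfl)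
  have hCz : C = 0 := by
    by_contra hne
    refine not_bddAbove_of_tendsto_deriv_pos (B := 2 + (C + 1)) hk
      (lt_of_le_of_ne hC0 (Ne.symm hne)) hkl ?_
    filter_upwards [hlim2.eventually_lt_const (show (1 : ℝ) < 2 by norm_num),
      hu'C.eventually_lt_const (show C < C + 1 by linarith)] with x h1 h2
    rw [sq_norm_eq_re_im] at h1 h2
    nlinarith [sq_nonneg ((u x).re - (u' x).re), sq_nonneg ((u x).im - (u' x).im)]
  rw [hCz] at hEC hu'C
  refine ⟨fun x => by simpa using hEC x, fun x => ?_⟩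
  have hJl : Tendsto (fun x => (u x).re * (u' x).im - (u x).im * (u' x).re) atTop (𝓝 0) := by
    refine squeeze_zero_norm' (a := fun x => ‖u x‖ * ‖u' x‖) (Eventually.of_forall fun y => ?_) ?_
    -- Lagrange's identity: `|u|²|u'|²` is the sum of the squares of `Im (ū u')` and `Re (ū u')`.
    · rw [Real.norm_eq_abs, ← norm_mul, ← abs_of_nonneg (norm_nonneg (u y * u' y)), ← sq_le_sq,
        norm_mul, mul_pow, sq_norm_eq_re_im, sq_norm_eq_re_im]
      nlinarith [sq_nonneg ((u y).re * (u' y).re + (u y).im * (u' y).im)]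
    · have h := hu'C.sqrt
      simp only [Real.sqrt_zero, Real.sqrt_sq (norm_nonneg _)] at h
      simpa using hlim'.mul h
  refine tendsto_nhds_unique ?_ hJl
  rw [funext fun y => const hJ y x]
  exact tendsto_const_nhds

/-- A kink vanishes somewhere. -/
theorem kink_exists_zero {f : ℝ → ℝ} (hf : ContDiff ℝ 1 f) (hF : Coercive f) {u u' : ℝ → ℂ}
    (hu : ∀ x, HasDerivAt u (u' x) x)
    (hu' : ∀ x, HasDerivAt u' (-(u x * (f (‖u x‖ ^ 2) : ℂ))) x)
    (hlim : Tendsto (fun x => ‖u x‖) (cocompact ℝ) (𝓝 1)) (hnc : ¬ ∃ z, ∀ x, u x = z) :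
    ∃ x, u x = 0 := by
  obtain ⟨hE, hJ⟩ := kink_first_integrals hf hF hu hu' hlim
  have cu : Continuous u := continuous_iff_continuousAt.2 fun x => (hu x).continuousAt
  -- Where `|u| = 1` the first integral gives `u' = 0`, so `u` shares its Cauchy data with an
  -- equilibrium and is constant.
  have hne : ∀ x, ‖u x‖ ≠ 1 := by
    intro x hx
    have h0 : u' x = 0 := by
      have := hE x
      rw [hx, one_pow, potential_one] at this
      simpa using this
    refine hnc ⟨u x, fun y => ?_⟩
    refine congrFun (profile_unique hf hu hu' (w := fun _ => u x) (w' := fun _ => 0) (x₀ := x)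
      (fun _ => hasDerivAt_const _ _) (fun y => ?_) rfl h0) y
    simp only [hx, one_pow, hF.apply_one hf.continuous, Complex.ofReal_zero, mul_zero, neg_zero]
    exact hasDerivAt_const _ _
  -- At a critical point of the modulus both `Re (ū u')` and `Im (ū u')` vanish, hence `|u| |u'| =
  -- 0`; and `u' ≠ 0` because `F(|u|²) > 0`.
  have hcrit : ∀ x, (u x).re * (u' x).re + (u x).im * (u' x).im = 0 → u x = 0 := by
    intro x hx
    have h : ‖u x‖ ^ 2 * ‖u' x‖ ^ 2 = 0 := by
      rw [sq_norm_eq_re_im, sq_norm_eq_re_im]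
      linear_combination ((u x).re * (u' x).re + (u x).im * (u' x).im) * hx +
        ((u x).re * (u' x).im - (u x).im * (u' x).re) * hJ x
    rcases mul_eq_zero.1 h with h | h
    · simpa using h
    · rw [hE x] at h
      refine absurd h (hF.potential_pos (by positivity) ?_).ne'
      intro h1
      exact hne x ((pow_eq_one_iff_of_nonneg (norm_nonneg _) two_ne_zero).1 h1)
  have hextr : ∀ x, IsLocalExtr (fun y => ‖u y‖ ^ 2) x → u x = 0 := fun x hx =>
    hcrit x (by simpa using hx.hasDerivAt_eq_zero (hasDerivAt_sq_norm (hu x)))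
  -- A value of `|u|` below the limit 1 yields a global minimum, a value above it a global maximum;
  -- either one is a zero of `u`.
  rcases lt_or_gt_of_ne (hne 0) with h0 | h0
  · obtain ⟨x, hx⟩ := cu.norm.exists_forall_le' (x₀ := 0)
      ((hlim.eventually_const_lt h0).mono fun x hx => hx.le)
    exact ⟨x, hextr x (Or.inl (Eventually.of_forall fun y => by
      exact pow_le_pow_left₀ (norm_nonneg _) (hx y) 2))⟩
  · obtain ⟨x, hx⟩ := cu.norm.exists_forall_ge' (x₀ := 0)
      ((hlim.eventually_lt_const h0).mono fun x hx => hx.le)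
    exact ⟨x, hextr x (Or.inr (Eventually.of_forall fun y => by
      exact pow_le_pow_left₀ (norm_nonneg _) (hx y) 2))⟩

/-- Two kinks differ by a translation and a constant phase. -/
theorem kink_unique {f : ℝ → ℝ} (hf : ContDiff ℝ 1 f) (hF : Coercive f) {v w : ℝ → ℂ}
    (hv : IsKink f v) (hw : IsKink f w) :
    ∃ θ a : ℝ, ∀ x, w x = Complex.exp (Complex.I * θ) * v (x + a) := by
  obtain ⟨v', hv1, hv2⟩ := (isTravellingWave_zero_iff hf.continuous).1 hv.1
  obtain ⟨w', hw1, hw2⟩ := (isTravellingWave_zero_iff hf.continuous).1 hw.1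
  obtain ⟨b, hb⟩ := kink_exists_zero hf hF hv1 hv2 hv.2.2 hv.2.1
  obtain ⟨c, hc⟩ := kink_exists_zero hf hF hw1 hw2 hw.2.2 hw.2.1
  have hb' := (kink_first_integrals hf hF hv1 hv2 hv.2.2).1 b
  have hc' := (kink_first_integrals hf hF hw1 hw2 hw.2.2).1 c
  rw [hb, norm_zero, zero_pow two_ne_zero] at hb'
  rw [hc, norm_zero, zero_pow two_ne_zero] at hc'
  have hpos : 0 < potential f 0 := hF.potential_pos le_rfl zero_ne_one
  have hvn : v' b ≠ 0 := fun h => by simp [h] at hb'; linarith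
  -- Both derivatives have modulus `√F(0)` at the zeros, so their quotient is the phase sought.
  have hn : ‖w' c / v' b‖ = 1 := by
    rw [norm_div, div_eq_one_iff_eq (norm_ne_zero_iff.2 hvn)]
    exact (sq_eq_sq₀ (norm_nonneg _) (norm_nonneg _)).1 (hc'.trans hb'.symm)
  obtain ⟨θ, hθ⟩ := (Complex.norm_eq_one_iff _).1 hn
  have hθn : ‖Complex.exp (Complex.I * θ)‖ = 1 := by
    rw [mul_comm]; exact Complex.norm_exp_ofReal_mul_I θ
  refine ⟨θ, b - c, fun x => congrFun (profile_unique hf hw1 hw2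
    (w' := fun x => Complex.exp (Complex.I * θ) * v' (x + (b - c))) (x₀ := c)
    (fun x => ((hv1 (x + (b - c))).comp_add_const x (b - c)).const_mul _) (fun x => ?_) ?_ ?_) x⟩
  · refine (((hv2 (x + (b - c))).comp_add_const x (b - c)).const_mul
      (Complex.exp (Complex.I * θ))).congr_deriv ?_
    rw [norm_mul, hθn, one_mul]
    ring
  · simp [hb, hc]
  · simp only [add_sub_cancel, mul_comm Complex.I]
    rw [hθ, div_mul_cancel₀ _ hvn]

/-! ### Existence of a real kink -/

/-- The speed `√F(s²)` of a kink at height `s`. -/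
noncomputable def speed (f : ℝ → ℝ) (s : ℝ) : ℝ := √(potential f (s ^ 2))

theorem continuous_speed {f : ℝ → ℝ} (hf : Continuous f) : Continuous (speed f) :=
  ((continuous_potential hf).comp (continuous_pow 2)).sqrt

theorem speed_nonneg (f : ℝ → ℝ) (s : ℝ) : 0 ≤ speed f s := Real.sqrt_nonneg _

theorem Coercive.sq_speed {f : ℝ → ℝ} (hF : Coercive f) (s : ℝ) :
    speed f s ^ 2 = potential f (s ^ 2) :=
  Real.sq_sqrt (hF.potential_nonneg (sq_nonneg s))

theorem Coercive.speed_pos {f : ℝ → ℝ} (hF : Coercive f) {s : ℝ} (hs : s ^ 2 ≠ 1) :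
    0 < speed f s :=
  Real.sqrt_pos.2 (hF.potential_pos (sq_nonneg s) hs)

/-! ### The hyperbolic tangent -/

theorem one_sub_tanh_sq (y : ℝ) : 1 - Real.tanh y ^ 2 = 1 / Real.cosh y ^ 2 := by
  have := (Real.cosh_pos y).ne'
  rw [Real.tanh_eq_sinh_div_cosh]
  field_simp
  linarith [Real.cosh_sq y]

theorem tanh_sq_lt_one (y : ℝ) : Real.tanh y ^ 2 < 1 := by
  have h := one_sub_tanh_sq y
  have : 0 < 1 / Real.cosh y ^ 2 := by have := Real.cosh_pos y; positivity
  linarith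

theorem hasDerivAt_real_tanh (y : ℝ) : HasDerivAt Real.tanh (1 - Real.tanh y ^ 2) y := by
  have hc := (Real.cosh_pos y).ne'
  have h := (Real.hasDerivAt_sinh y).div (Real.hasDerivAt_cosh y) hc
  rw [one_sub_tanh_sq]
  refine (h.congr_of_eventuallyEq ?_).congr_deriv ?_
  · exact Eventually.of_forall fun x => Real.tanh_eq_sinh_div_cosh x
  · congr 1
    linarith [Real.cosh_sq y]

theorem tendsto_tanh_atTop : Tendsto Real.tanh atTop (𝓝 1) := by
  have h1 : Tendsto (fun y : ℝ => Real.exp (-(2 * y))) atTop (𝓝 0) :=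
    Real.tendsto_exp_neg_atTop_nhds_zero.comp (tendsto_id.const_mul_atTop two_pos)
  have h2 : Tendsto (fun y : ℝ => (1 - Real.exp (-(2 * y))) / (1 + Real.exp (-(2 * y)))) atTop
      (𝓝 ((1 - 0) / (1 + 0))) :=
    (tendsto_const_nhds.sub h1).div (tendsto_const_nhds.add h1) (by norm_num)
  rw [sub_zero, add_zero, div_one] at h2
  refine h2.congr fun y => ?_
  rw [Real.tanh_eq_sinh_div_cosh, Real.sinh_eq, Real.cosh_eq]
  have : Real.exp (-(2 * y)) = Real.exp (-y) / Real.exp y := by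
    rw [← Real.exp_sub]; congr 1; ring
  rw [this]
  have := Real.exp_pos y
  have := Real.exp_pos (-y)
  field_simp

theorem tendsto_tanh_atBot : Tendsto Real.tanh atBot (𝓝 (-1)) := by
  have := (tendsto_tanh_atTop.comp tendsto_neg_atBot_atTop).neg
  refine this.congr fun y => ?_
  simp [Real.tanh_neg]

/-- A `C¹` function on the line with derivative bounded below by a positive constant has a
differentiable inverse. -/
theorem exists_inverse_of_deriv_ge {H h : ℝ → ℝ} {c : ℝ} (hc : 0 < c)
    (hH : ∀ y, HasDerivAt H (h y) y) (hh : ∀ y, c ≤ h y) :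
    ∃ Y : ℝ ≃ₜ ℝ, StrictMono Y ∧ ∀ x, HasDerivAt Y (h (Y x))⁻¹ x := by
  have hcont : Continuous H := continuous_iff_continuousAt.2 fun y => (hH y).continuousAt
  have hmono : StrictMono H := strictMono_of_deriv_pos fun y => by
    rw [(hH y).deriv]; exact hc.trans_le (hh y)
  have hlow : ∀ x y, x ≤ y → c * (y - x) ≤ H y - H x :=
    fun x y hxy => mul_sub_le_image_sub_of_le_deriv (fun y => (hH y).differentiableAt)
      (fun y => by rw [(hH y).deriv]; exact hh y) hxy
  have hsurj : Function.Surjective H := by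
    refine hcont.surjective ?_ ?_
    · refine tendsto_atTop_mono' _ (f₁ := fun y => c * y + H 0) ?_
        (tendsto_atTop_add_const_right _ _ (tendsto_id.const_mul_atTop hc))
      filter_upwards [eventually_ge_atTop 0] with y hy
      have := hlow 0 y hy
      linarith
    · refine tendsto_atBot_mono' _ ?_
        (tendsto_atBot_add_const_right _ (H 0) (tendsto_id.const_mul_atBot hc))
      filter_upwards [eventually_le_atBot 0] with y hy
      have := hlow y 0 hy
      simp only [id]
      linarith
  let e := hmono.orderIsoOfSurjective H hsurj
  refine ⟨e.symm.toHomeomorph, e.symm.strictMono, fun x => ?_⟩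
  exact (hH _).of_local_left_inverse e.symm.toHomeomorph.continuous.continuousAt
    (hc.trans_le (hh _)).ne' (Eventually.of_forall fun y => e.apply_symm_apply y)

/-- There is an increasing heteroclinic orbit `w' = √F(w²)` from `-1` to `1`. -/
theorem exists_real_kink {f : ℝ → ℝ} (hf : ContDiff ℝ 1 f) (hF : Coercive f) :
    ∃ w : ℝ → ℝ, (∀ x, HasDerivAt w (speed f (w x)) x) ∧ (∀ x, w x ^ 2 < 1) ∧
      Tendsto w atTop (𝓝 1) ∧ Tendsto w atBot (𝓝 (-1)) := by
  obtain ⟨L, hL, hle⟩ := hF.exists_potential_le hf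
  have hpos : ∀ y, 0 < speed f (Real.tanh y) := fun y => hF.speed_pos (tanh_sq_lt_one y).ne
  have htc : Continuous Real.tanh :=
    continuous_iff_continuousAt.2 fun y => (hasDerivAt_real_tanh y).continuousAt
  -- With the substitution `w = tanh y`, the equation `w' = √F(w²)` becomes `dx/dy = h y`; `x` is
  -- the primitive of `h`, to be inverted.
  set h : ℝ → ℝ := fun y => (1 - Real.tanh y ^ 2) / speed f (Real.tanh y) with hdef
  have hcont : Continuous h := by
    refine Continuous.div (by fun_prop) ((continuous_speed hf.continuous).comp htc) ?_
    exact fun y => (hpos y).ne'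
  -- The quadratic upper bound `F(ρ) ≤ L (1 - ρ)²` means that the orbit needs infinite time to reach
  -- `±1`.
  have hlow : ∀ y, 1 / √L ≤ h y := by
    intro y
    have h1 := (tanh_sq_lt_one y).le
    rw [hdef, div_le_div_iff₀ (by positivity) (hpos y), one_mul]
    refine (Real.sqrt_le_sqrt (hle _ ⟨sq_nonneg _, h1⟩)).trans ?_
    rw [Real.sqrt_mul hL.le, Real.sqrt_sq (sub_nonneg.2 h1), mul_comm]
  obtain ⟨Y, hYm, hY⟩ := exists_inverse_of_deriv_ge (H := fun y => ∫ t in (0 : ℝ)..y, h t)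
    (by positivity) (fun y => hcont.integral_hasStrictDerivAt 0 y |>.hasDerivAt) hlow
  refine ⟨fun x => Real.tanh (Y x), fun x => ?_, fun x => tanh_sq_lt_one _,
    tendsto_tanh_atTop.comp (hYm.monotone.tendsto_atTop_atTop fun b => ⟨Y.symm b, by simp⟩),
    tendsto_tanh_atBot.comp (hYm.monotone.tendsto_atBot_atBot fun b => ⟨Y.symm b, by simp⟩)⟩
  refine ((hasDerivAt_real_tanh (Y x)).comp x (hY x)).congr_deriv ?_
  have h1 : 1 - Real.tanh (Y x) ^ 2 ≠ 0 := (sub_pos.2 (tanh_sq_lt_one _)).ne'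
  simp only [hdef, inv_div]
  field_simp

/-- Differentiating `w' = √F(w²)` gives the second order equation; the root is differentiable
because `w² < 1` keeps `F(w²)` positive. -/
theorem isKink_ofReal {f : ℝ → ℝ} (hf : ContDiff ℝ 1 f) (hF : Coercive f) {w : ℝ → ℝ}
    (hw : ∀ x, HasDerivAt w (speed f (w x)) x) (hw1 : ∀ x, w x ^ 2 < 1)
    (htop : Tendsto w atTop (𝓝 1)) (hbot : Tendsto w atBot (𝓝 (-1))) :
    IsKink f fun x => (w x : ℂ) := by
  refine ⟨(isTravellingWave_zero_iff hf.continuous).2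
    ⟨fun x => (speed f (w x) : ℂ), fun x => (hw x).ofReal_comp, fun x => ?_⟩, ?_, ?_⟩
  · have hs := hF.speed_pos (hw1 x).ne
    have h0 : HasDerivAt (fun x => potential f (w x ^ 2)) (-f (w x ^ 2) * _) x :=
      HasDerivAt.comp (h₂ := potential f) x (hasDerivAt_potential hf.continuous (w x ^ 2))
        ((hw x).fun_pow 2)
    have h1 := h0.sqrt (hF.potential_pos (sq_nonneg _) (hw1 x).ne).ne'
    have h2 : HasDerivAt (fun x => speed f (w x)) (-(w x * f (w x ^ 2))) x := by
      refine h1.congr_deriv ?_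
      change _ / (2 * speed f (w x)) = _
      field_simp
      push_cast
      ring
    refine h2.ofReal_comp.congr_deriv ?_
    rw [Complex.norm_real, Real.norm_eq_abs, sq_abs]
    push_cast
    ring
  · rintro ⟨z, hz⟩
    have hc : ∀ x, w x = z.re := fun x => by rw [← hz x]; simp
    rw [funext hc] at htop hbot
    have h1 := tendsto_nhds_unique htop tendsto_const_nhds
    have h2 := tendsto_nhds_unique hbot tendsto_const_nhds
    linarith
  · simp only [Complex.norm_real, Real.norm_eq_abs, cocompact_eq_atBot_atTop]
    refine Tendsto.sup ?_ ?_
    · simpa using hbot.abs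
    · simpa using htop.abs

/-! ### The action and the potential energy of the real kink -/

/-- The primitive `∫₀ˢ √F(t²) dt`. -/
noncomputable def action (f : ℝ → ℝ) (s : ℝ) : ℝ := ∫ t in (0 : ℝ)..s, speed f t

theorem hasDerivAt_action {f : ℝ → ℝ} (hf : Continuous f) (s : ℝ) :
    HasDerivAt (action f) (speed f s) s :=
  ((continuous_speed hf).integral_hasStrictDerivAt 0 s).hasDerivAt

theorem continuous_action {f : ℝ → ℝ} (hf : Continuous f) : Continuous (action f) :=
  continuous_iff_continuousAt.2 fun s => (hasDerivAt_action hf s).continuousAt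

theorem monotone_action {f : ℝ → ℝ} (hf : Continuous f) : Monotone (action f) :=
  monotone_of_deriv_nonneg (fun s => (hasDerivAt_action hf s).differentiableAt) fun s => by
    rw [(hasDerivAt_action hf s).deriv]; exact speed_nonneg f s

theorem action_zero (f : ℝ → ℝ) : action f 0 = 0 := by simp [action]

theorem action_neg (f : ℝ → ℝ) (s : ℝ) : action f (-s) = -action f s := by
  have h := intervalIntegral.integral_comp_neg (a := 0) (b := s) (speed f)
  have e : ∀ t, speed f (-t) = speed f t := fun t => by simp [speed]
  simp only [e, neg_zero] at h
  rw [action, action, h, intervalIntegral.integral_symm]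

/-- Along the orbit `F(w²) = √F(w²) w'` is the derivative of `action f (w x)`, which runs from
`-action f 1` to `action f 1` by oddness. -/
theorem lintegral_potential_real_kink {f : ℝ → ℝ} (hf : ContDiff ℝ 1 f) (hF : Coercive f)
    {w : ℝ → ℝ} (hw : ∀ x, HasDerivAt w (speed f (w x)) x)
    (htop : Tendsto w atTop (𝓝 1)) (hbot : Tendsto w atBot (𝓝 (-1))) :
    ∫⁻ x, ENNReal.ofReal (potential f (w x ^ 2)) = ENNReal.ofReal (2 * action f 1) := by
  have hd : ∀ x, HasDerivAt (fun x => action f (w x)) (potential f (w x ^ 2)) x := fun x => by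
    refine ((hasDerivAt_action hf.continuous (w x)).comp x (hw x)).congr_deriv ?_
    rw [← hF.sq_speed, sq]
  have hn : ∀ x, 0 ≤ potential f (w x ^ 2) := fun x => hF.potential_nonneg (sq_nonneg _)
  have ht := ((continuous_action hf.continuous).tendsto 1).comp htop
  have hb := ((continuous_action hf.continuous).tendsto (-1)).comp hbot
  have hcont : Continuous fun x => potential f (w x ^ 2) :=
    (continuous_potential hf.continuous).comp
      ((continuous_iff_continuousAt.2 fun x => (hw x).continuousAt).pow 2)
  have hi : Integrable fun x => potential f (w x ^ 2) := by
    refine integrable_of_intervalIntegral_norm_tendsto (l := atTop) (a := fun i : ℝ => -i)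
      (b := id) (action f 1 - action f (-1)) (fun i => ?_) tendsto_neg_atTop_atBot tendsto_id ?_
    · exact hcont.integrableOn_Ioc
    · have e : ∀ i : ℝ, ∫ x in -i..i, ‖potential f (w x ^ 2)‖
          = action f (w i) - action f (w (-i)) := fun i => by
        simp only [Real.norm_of_nonneg (hn _)]
        exact intervalIntegral.integral_eq_sub_of_hasDerivAt (fun x _ => hd x)
          (hcont.intervalIntegrable _ _)
      simp only [id, e]
      exact ht.sub (hb.comp tendsto_neg_atTop_atBot)
  rw [← ofReal_integral_eq_lintegral_ofReal hi (Eventually.of_forall hn),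
    integral_of_hasDerivAt_of_tendsto hd hi hb ht, action_neg]
  congr 1
  ring

/-! ### Weak derivatives on the line -/

/-- This is the fundamental lemma of the calculus of variations. It lets the chosen `weakDeriv` be
replaced by any explicit weak derivative inside integrals. -/
theorem HasWeakDeriv.ae_eq {v g₁ g₂ : ℝ → ℂ} (h₁ : HasWeakDeriv v g₁) (h₂ : HasWeakDeriv v g₂) :
    g₁ =ᵐ[volume] g₂ :=
  ae_eq_of_integral_contDiff_smul_eq h₁.2.1 h₂.2.1 fun φ hφ hc =>
    neg_injective ((h₁.2.2 φ hφ hc).symm.trans (h₂.2.2 φ hφ hc))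

theorem hasWeakDeriv_weakDeriv {v g : ℝ → ℂ} (h : HasWeakDeriv v g) :
    HasWeakDeriv v (weakDeriv v) := by
  have hex : ∃ g, HasWeakDeriv v g := ⟨g, h⟩
  rw [weakDeriv, dif_pos hex]
  exact hex.choose_spec

theorem hasWeakDeriv_of_hasDerivAt {v g : ℝ → ℂ} (h : ∀ x, HasDerivAt v (g x) x)
    (hg : Continuous g) : HasWeakDeriv v g := by
  have hv : Continuous v := continuous_iff_continuousAt.2 fun x => (h x).continuousAt
  refine ⟨hv.locallyIntegrable, hg.locallyIntegrable, fun φ hφ hc => ?_⟩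
  have hφ' : Continuous (deriv φ) := hφ.continuous_deriv (by norm_num)
  have hd : ∀ x, HasDerivAt (fun x => φ x • v x) (φ x • g x + deriv φ x • v x) x := fun x =>
    ((hφ.differentiable (by norm_num) x).hasDerivAt).smul (h x)
  have i1 : Integrable fun x => φ x • g x :=
    (hφ.continuous.smul hg).integrable_of_hasCompactSupport hc.smul_right
  have i2 : Integrable fun x => deriv φ x • v x :=
    (hφ'.smul hv).integrable_of_hasCompactSupport hc.deriv.smul_right
  have i3 : Integrable fun x => φ x • v x :=
    (hφ.continuous.smul hv).integrable_of_hasCompactSupport hc.smul_right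
  have := integral_eq_zero_of_hasDerivAt_of_integrable hd (i1.add i2) i3
  rw [integral_add i1 i2] at this
  exact eq_neg_of_add_eq_zero_right this

theorem weakDeriv_ae_eq_of_hasDerivAt {v g : ℝ → ℂ} (h : ∀ x, HasDerivAt v (g x) x)
    (hg : Continuous g) : weakDeriv v =ᵐ[volume] g :=
  (hasWeakDeriv_weakDeriv (hasWeakDeriv_of_hasDerivAt h hg)).ae_eq (hasWeakDeriv_of_hasDerivAt h hg)

theorem memL2loc_of_continuous {v : ℝ → ℂ} (hv : Continuous v) : MemL2loc v := fun K hK => by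
  have : IsFiniteMeasure (volume.restrict K) := ⟨by simpa using hK.measure_lt_top⟩
  obtain ⟨C, hC⟩ := hK.exists_bound_of_continuousOn hv.continuousOn
  exact MemLp.of_bound hv.aestronglyMeasurable C
    ((ae_restrict_mem hK.measurableSet).mono hC)

theorem memH1loc_of_hasDerivAt {v g : ℝ → ℂ} (h : ∀ x, HasDerivAt v (g x) x)
    (hg : Continuous g) : MemH1loc v := by
  have hv : Continuous v := continuous_iff_continuousAt.2 fun x => (h x).continuousAt
  exact ⟨hv, memL2loc_of_continuous hv, g, hasWeakDeriv_of_hasDerivAt h hg,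
    memL2loc_of_continuous hg⟩

/-! ### Smooth steps as test functions -/

/-- A smooth step from `0` to `1` on `[c, c + 1/n]`. -/
noncomputable def smoothStep (n : ℕ) (c x : ℝ) : ℝ := Real.smoothTransition (n * (x - c))

theorem contDiff_smoothStep (n : ℕ) (c : ℝ) : ContDiff ℝ ∞ (smoothStep n c) :=
  Real.smoothTransition.contDiff.comp (contDiff_const.mul (contDiff_id.sub contDiff_const))

theorem smoothStep_of_le (n : ℕ) {c x : ℝ} (h : x ≤ c) : smoothStep n c x = 0 :=
  Real.smoothTransition.zero_of_nonpos
    (mul_nonpos_of_nonneg_of_nonpos (Nat.cast_nonneg n) (sub_nonpos.2 h))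

theorem smoothStep_of_one_le {n : ℕ} {c x : ℝ} (h : 1 ≤ n * (x - c)) : smoothStep n c x = 1 :=
  Real.smoothTransition.one_of_one_le h

theorem smoothStep_of_add_one_le {n : ℕ} (hn : n ≠ 0) {c x : ℝ} (h : c + 1 ≤ x) :
    smoothStep n c x = 1 := by
  have : (1 : ℝ) ≤ n := by exact_mod_cast Nat.one_le_iff_ne_zero.2 hn
  exact smoothStep_of_one_le (by nlinarith)

theorem hasDerivAt_smoothStep (n : ℕ) (c x : ℝ) :
    HasDerivAt (smoothStep n c) (n * deriv Real.smoothTransition (n * (x - c))) x := by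
  have h1 : HasDerivAt Real.smoothTransition _ (n * (x - c)) :=
    ((Real.smoothTransition.contDiff (n := 1)).differentiable (by simp) _).hasDerivAt
  refine (HasDerivAt.comp (h₂ := Real.smoothTransition) x h1
    (((hasDerivAt_id x).sub_const c).const_mul (n : ℝ))).congr_deriv ?_
  simp [mul_comm]

theorem continuous_deriv_smoothTransition : Continuous (deriv Real.smoothTransition) :=
  (Real.smoothTransition.contDiff (n := 1)).continuous_deriv (by simp)

theorem deriv_smoothTransition_eq_zero {t : ℝ} (ht : t ∉ Set.Icc (0 : ℝ) 1) :
    deriv Real.smoothTransition t = 0 := by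
  rw [Set.mem_Icc, not_and_or, not_le, not_le] at ht
  rcases ht with ht | ht
  · have : Real.smoothTransition =ᶠ[𝓝 t] fun _ => 0 := by
      filter_upwards [gt_mem_nhds ht] with y hy
      exact Real.smoothTransition.zero_of_nonpos (le_of_lt hy)
    rw [this.deriv_eq, deriv_const]
  · have : Real.smoothTransition =ᶠ[𝓝 t] fun _ => 1 := by
      filter_upwards [lt_mem_nhds ht] with y hy
      exact Real.smoothTransition.one_of_one_le (le_of_lt hy)
    rw [this.deriv_eq, deriv_const]

theorem hasCompactSupport_deriv_smoothTransition :
    HasCompactSupport (deriv Real.smoothTransition) :=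
  HasCompactSupport.intro isCompact_Icc fun _ ht => deriv_smoothTransition_eq_zero ht

theorem integral_deriv_smoothTransition : ∫ t, deriv Real.smoothTransition t = 1 := by
  have h := integral_of_hasDerivAt_of_tendsto (f := Real.smoothTransition) (m := 0) (n := 1)
    (fun x => ((Real.smoothTransition.contDiff (n := 1)).differentiable (by simp) x).hasDerivAt)
    (continuous_deriv_smoothTransition.integrable_of_hasCompactSupport
      hasCompactSupport_deriv_smoothTransition)
    (tendsto_const_nhds.congr' ((eventually_le_atBot 0).mono fun x hx =>
      (Real.smoothTransition.zero_of_nonpos hx).symm))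
    (tendsto_const_nhds.congr' ((eventually_ge_atTop 1).mono fun x hx =>
      (Real.smoothTransition.one_of_one_le hx).symm))
  rw [h, sub_zero]

theorem integrable_deriv_smoothStep_smul {v : ℝ → ℂ} (hv : Continuous v) {n : ℕ} (hn : n ≠ 0)
    (c : ℝ) : Integrable fun x => deriv (smoothStep n c) x • v x := by
  rw [funext fun x => (hasDerivAt_smoothStep n c x).deriv]
  have hc : HasCompactSupport fun x => n * deriv Real.smoothTransition (n * (x - c)) := by
    refine HasCompactSupport.intro (isCompact_Icc (a := c) (b := c + 1)) fun x hx => ?_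
    rw [deriv_smoothTransition_eq_zero, mul_zero]
    contrapose! hx
    have h0 : (0 : ℝ) < n := by exact_mod_cast Nat.pos_of_ne_zero hn
    have h1 : (1 : ℝ) ≤ n := by exact_mod_cast Nat.one_le_iff_ne_zero.2 hn
    constructor <;> nlinarith [hx.1, hx.2]
  have := continuous_deriv_smoothTransition
  exact Continuous.integrable_of_hasCompactSupport (by fun_prop) hc.smul_right

/-- The derivatives of the steps form an approximate identity at `c`: they have mass one and live on
`[c, c + 1/n]`. Rescaling by `t = n (x - c)` reduces the limit to dominated convergence. -/
theorem tendsto_integral_deriv_smoothStep {v : ℝ → ℂ} (hv : Continuous v) (c : ℝ) :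
    Tendsto (fun n : ℕ => ∫ x, deriv (smoothStep n c) x • v x) atTop (𝓝 (v c)) := by
  have key : Tendsto (fun n : ℕ => ∫ t, deriv Real.smoothTransition t • v (t / n + c)) atTop
      (𝓝 (∫ t, deriv Real.smoothTransition t • v c)) := by
    obtain ⟨M, hM⟩ := (isCompact_Icc (a := c) (b := c + 1)).exists_bound_of_continuousOn
      hv.continuousOn
    have hcont := continuous_deriv_smoothTransition
    refine tendsto_integral_filter_of_dominated_convergence
      (fun t => ‖deriv Real.smoothTransition t‖ * M) (Eventually.of_forall fun n => ?_) ?_ ?_ ?_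
    · exact Continuous.aestronglyMeasurable (by fun_prop)
    · filter_upwards [eventually_ne_atTop 0] with n hn
      refine Eventually.of_forall fun t => ?_
      rw [norm_smul]
      by_cases ht : t ∈ Set.Icc (0 : ℝ) 1
      · have h1 : (1 : ℝ) ≤ n := by exact_mod_cast Nat.one_le_iff_ne_zero.2 hn
        have h2 : 0 ≤ t / n := div_nonneg ht.1 (by positivity)
        have h3 : t / n ≤ 1 := (div_le_one (by positivity)).2 (ht.2.trans h1)
        exact mul_le_mul_of_nonneg_left (hM _ ⟨by linarith, by linarith⟩) (norm_nonneg _)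
      · simp [deriv_smoothTransition_eq_zero ht]
    · exact (hcont.integrable_of_hasCompactSupport
        hasCompactSupport_deriv_smoothTransition).norm.mul_const M
    · refine Eventually.of_forall fun t => ?_
      have h : Tendsto (fun n : ℕ => t / n + c) atTop (𝓝 (0 + c)) :=
        (tendsto_const_div_atTop_nhds_zero_nat t).add_const c
      rw [zero_add] at h
      exact ((hv.tendsto c).comp h).const_smul _
  rw [integral_smul_const, integral_deriv_smoothTransition, one_smul] at key
  refine key.congr' ?_
  filter_upwards [eventually_ne_atTop 0] with n hn
  have h0 : (n : ℝ) ≠ 0 := by exact_mod_cast hn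
  have e : ∀ x, deriv (smoothStep n c) x • v x = (n : ℝ) •
      (fun t => deriv Real.smoothTransition t • v (t / n + c)) (n * (x - c)) := fun x => by
    rw [(hasDerivAt_smoothStep n c x).deriv, mul_smul]
    simp only
    rw [mul_div_cancel_left₀ _ h0, sub_add_cancel]
  simp_rw [e]
  rw [integral_smul, integral_sub_right_eq_self
    (fun x => (fun t => deriv Real.smoothTransition t • v (t / n + c)) (n * x)) c,
    Measure.integral_comp_mul_left
      (fun t => deriv Real.smoothTransition t • v (t / n + c)), smul_smul, abs_of_nonneg (by positivity),
    mul_inv_cancel₀ h0, one_smul]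

/-- A continuous function is the integral of its weak derivative. -/
theorem HasWeakDeriv.sub_eq_integral {v g : ℝ → ℂ} (hv : Continuous v) (h : HasWeakDeriv v g)
    {a b : ℝ} (hab : a ≤ b) : v b - v a = ∫ x in a..b, g x := by
  -- These test functions converge pointwise to the indicator of `(a, b]`, while their derivatives
  -- concentrate at `a` with mass `1` and at `b` with mass `-1`.
  set φ : ℕ → ℝ → ℝ := fun n x => smoothStep n a x - smoothStep n b x with hφ
  have hsm : ∀ n, ContDiff ℝ ∞ (φ n) := fun n =>
    (contDiff_smoothStep n a).sub (contDiff_smoothStep n b)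
  have hzero : ∀ n, n ≠ 0 → ∀ x ∉ Set.Icc a (b + 1), φ n x = 0 := by
    intro n hn x hx
    rw [Set.mem_Icc, not_and_or, not_le, not_le] at hx
    rcases hx with hx | hx
    · simp [hφ, smoothStep_of_le n hx.le, smoothStep_of_le n (hx.le.trans hab)]
    · simp [hφ, smoothStep_of_add_one_le hn hx.le,
        smoothStep_of_add_one_le hn (by linarith : a + 1 ≤ x)]
  have h1 : Tendsto (fun n => ∫ x, deriv (φ n) x • v x) atTop (𝓝 (v a - v b)) := by
    refine ((tendsto_integral_deriv_smoothStep hv a).sub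
      (tendsto_integral_deriv_smoothStep hv b)).congr' ?_
    filter_upwards [eventually_ne_atTop 0] with n hn
    rw [← integral_sub (integrable_deriv_smoothStep_smul hv hn a)
      (integrable_deriv_smoothStep_smul hv hn b)]
    refine integral_congr_ae (Eventually.of_forall fun x => ?_)
    simp only
    rw [← sub_smul, ((hasDerivAt_smoothStep n a x).fun_sub (hasDerivAt_smoothStep n b x)).deriv,
      (hasDerivAt_smoothStep n a x).deriv, (hasDerivAt_smoothStep n b x).deriv]
  have h2 : Tendsto (fun n => ∫ x, φ n x • g x) atTop
      (𝓝 (∫ x, (Set.Ioc a b).indicator g x)) := by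
    refine tendsto_integral_filter_of_dominated_convergence
      ((Set.Icc a (b + 1)).indicator fun x => ‖g x‖) (Eventually.of_forall fun n => ?_) ?_ ?_ ?_
    · exact (hsm n).continuous.aestronglyMeasurable.smul h.2.1.aestronglyMeasurable
    · filter_upwards [eventually_ne_atTop 0] with n hn
      refine Eventually.of_forall fun x => ?_
      by_cases hx : x ∈ Set.Icc a (b + 1)
      · rw [Set.indicator_of_mem hx, norm_smul]
        refine mul_le_of_le_one_left (norm_nonneg _) ?_
        rw [Real.norm_eq_abs, abs_le]
        have n1 := Real.smoothTransition.nonneg (n * (x - a))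
        have n2 := Real.smoothTransition.nonneg (n * (x - b))
        have l1 := Real.smoothTransition.le_one (n * (x - a))
        have l2 := Real.smoothTransition.le_one (n * (x - b))
        simp only [hφ, smoothStep]
        constructor <;> linarith
      · rw [Set.indicator_of_notMem hx, hzero n hn x hx, zero_smul, norm_zero]
    · exact IntegrableOn.integrable_indicator
        (h.2.1.integrableOn_isCompact isCompact_Icc).norm measurableSet_Icc
    · have step : ∀ c x : ℝ, c < x → ∀ᶠ n : ℕ in atTop, smoothStep n c x = 1 := by
        intro c x hx
        filter_upwards [(tendsto_natCast_atTop_atTop.atTop_mul_const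
          (sub_pos.2 hx)).eventually_ge_atTop 1] with n hn
        exact smoothStep_of_one_le hn
      refine Eventually.of_forall fun x => tendsto_const_nhds.congr' ?_
      rcases le_or_gt x a with hxa | hxa
      · refine Eventually.of_forall fun n => ?_
        rw [Set.indicator_of_notMem (fun hx => hxa.not_gt hx.1)]
        simp [hφ, smoothStep_of_le n hxa, smoothStep_of_le n (hxa.trans hab)]
      rcases le_or_gt x b with hxb | hxb
      · filter_upwards [step a x hxa] with n hn
        rw [Set.indicator_of_mem (Set.mem_Ioc.2 ⟨hxa, hxb⟩)]
        simp [hφ, hn, smoothStep_of_le n hxb]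
      · filter_upwards [step a x hxa, step b x hxb] with n hn hn'
        rw [Set.indicator_of_notMem (fun hx => hxb.not_ge hx.2)]
        simp [hφ, hn, hn']
  have h3 : v a - v b = -∫ x, (Set.Ioc a b).indicator g x := by
    refine tendsto_nhds_unique h1 (h2.neg.congr' ?_)
    filter_upwards [eventually_ne_atTop 0] with n hn
    exact (h.2.2 (φ n) (hsm n) (HasCompactSupport.intro isCompact_Icc (hzero n hn))).symm
  rw [intervalIntegral.integral_of_le hab, ← integral_indicator measurableSet_Ioc, ← neg_sub, h3,
    neg_neg]

/-! ### The lower bound for the energy -/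

/-- Increments of `ψ` are bounded by increments of `m` if this holds locally to the right. -/
theorem abs_sub_le_sub_of_local {ψ m : ℝ → ℝ} (hψ : Continuous ψ) (hm : Continuous m)
    (h : ∀ x, ∀ᶠ y in 𝓝[>] x, |ψ y - ψ x| ≤ m y - m x) {a b : ℝ} (hab : a ≤ b) :
    |ψ b - ψ a| ≤ m b - m a := by
  have hclosed : IsClosed {x | |ψ x - ψ a| ≤ m x - m a} := isClosed_le (by fun_prop) (by fun_prop)
  refine (hclosed.inter isClosed_Icc).Icc_subset_of_forall_exists_gt (by simp) ?_
    (Set.right_mem_Icc.2 hab)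
  rintro x ⟨hx, -⟩ y hy
  obtain ⟨z, hz, hzm⟩ := ((h x).and (Ioc_mem_nhdsGT hy)).exists
  refine ⟨z, ?_, hzm⟩
  have := abs_sub_le (ψ z) (ψ x) (ψ a)
  simp only [Set.mem_ofPred_eq] at hx ⊢
  linarith

/-- This replaces a chain rule for `action f |v|`, where `v` need not be differentiable. Over short
intervals `speed f |v|` is nearly constant, so the bound holds up to an error `η ∫ |g|`; local
bounds are then chained and `η` tends to 0. -/
theorem abs_action_sub_le {f : ℝ → ℝ} (hf : Continuous f) {v g : ℝ → ℂ} (hv : Continuous v)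
    (h : HasWeakDeriv v g) {a b : ℝ} (hab : a ≤ b) :
    |action f ‖v b‖ - action f ‖v a‖| ≤ ∫ x in a..b, speed f ‖v x‖ * ‖g x‖ := by
  have hsv : Continuous fun x => speed f ‖v x‖ := (continuous_speed hf).comp hv.norm
  have hgi : ∀ a b, IntervalIntegrable g volume a b := fun a b =>
    (h.2.1.integrableOn_isCompact isCompact_uIcc).intervalIntegrable
  have hg : ∀ a b, IntervalIntegrable (fun x => ‖g x‖) volume a b := fun a b => (hgi a b).norm
  have hsg : ∀ a b, IntervalIntegrable (fun x => speed f ‖v x‖ * ‖g x‖) volume a b := fun a b =>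
    (hg a b).continuousOn_mul hsv.continuousOn
  have hη : ∀ η : ℝ, 0 < η → |action f ‖v b‖ - action f ‖v a‖| ≤
      (∫ x in a..b, speed f ‖v x‖ * ‖g x‖) + η * ∫ x in a..b, ‖g x‖ := by
    intro η hη
    set m : ℝ → ℝ := fun x => (∫ t in a..x, speed f ‖v t‖ * ‖g t‖) + η * ∫ t in a..x, ‖g t‖ with hm
    have hmc : Continuous m :=
      (intervalIntegral.continuous_primitive hsg a).add
        ((intervalIntegral.continuous_primitive hg a).const_mul η)
    have := abs_sub_le_sub_of_local (ψ := fun x => action f ‖v x‖) (m := m)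
      ((continuous_action hf).comp hv.norm) hmc ?_ hab
    · simpa [hm] using this
    intro x
    obtain ⟨r, hr, hsr⟩ := Metric.continuousAt_iff.1
      ((continuous_speed hf).continuousAt (x := ‖v x‖)) (η / 2) (half_pos hη)
    obtain ⟨δ, hδ, hvδ⟩ := Metric.continuousAt_iff.1 (hv.norm.continuousAt (x := x)) r hr
    filter_upwards [Ioo_mem_nhdsGT (show x < x + δ by linarith)] with y hy
    have hnear : ∀ t ∈ Set.Icc x y, dist ‖v t‖ ‖v x‖ < r := fun t ht =>
      hvδ (by rw [Real.dist_eq, abs_lt]; constructor <;> linarith [ht.1, ht.2, hy.2])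
    -- Mean value inequality on the ball around `|v x|` where `speed f` varies by less than `η / 2`;
    -- the other half of `η` is spent in `h3`.
    have h1 : |action f ‖v y‖ - action f ‖v x‖| ≤ (speed f ‖v x‖ + η / 2) * |‖v y‖ - ‖v x‖| := by
      refine (convex_ball ‖v x‖ r).norm_image_sub_le_of_norm_hasDerivWithin_le
        (fun s _ => (hasDerivAt_action hf s).hasDerivWithinAt) (fun s hs => ?_)
        (Metric.mem_ball_self hr) (hnear y ⟨hy.1.le, le_rfl⟩)
      have := hsr hs
      rw [Real.dist_eq, abs_lt] at this
      rw [Real.norm_of_nonneg (speed_nonneg f s)]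
      linarith
    have h2 : |‖v y‖ - ‖v x‖| ≤ ∫ t in x..y, ‖g t‖ := by
      refine (abs_norm_sub_norm_le _ _).trans ?_
      rw [h.sub_eq_integral hv hy.1.le]
      exact intervalIntegral.norm_integral_le_integral_norm hy.1.le
    have h3 : (speed f ‖v x‖ + η / 2) * ∫ t in x..y, ‖g t‖ ≤
        ∫ t in x..y, (speed f ‖v t‖ * ‖g t‖ + η * ‖g t‖) := by
      rw [← intervalIntegral.integral_const_mul]
      refine intervalIntegral.integral_mono_on hy.1.le ((hg x y).const_mul _)
        ((hsg x y).add ((hg x y).const_mul _)) fun t ht => ?_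
      have := hsr (hnear t ht)
      rw [Real.dist_eq, abs_lt] at this
      rw [← add_mul]
      exact mul_le_mul_of_nonneg_right (by linarith) (norm_nonneg _)
    have h4 : m y - m x = ∫ t in x..y, (speed f ‖v t‖ * ‖g t‖ + η * ‖g t‖) := by
      rw [intervalIntegral.integral_add (hsg x y) ((hg x y).const_mul _),
        intervalIntegral.integral_const_mul,
        ← intervalIntegral.integral_interval_sub_left (hsg a y) (hsg a x),
        ← intervalIntegral.integral_interval_sub_left (hg a y) (hg a x)]
      simp only [hm]
      ring
    rw [h4]
    have h5 : 0 ≤ speed f ‖v x‖ + η / 2 := add_nonneg (speed_nonneg _ _) (half_pos hη).le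
    exact h1.trans ((mul_le_mul_of_nonneg_left h2 h5).trans h3)
  have hlim : Tendsto (fun η : ℝ => (∫ x in a..b, speed f ‖v x‖ * ‖g x‖) + η * ∫ x in a..b, ‖g x‖)
      (𝓝[>] 0) (𝓝 ((∫ x in a..b, speed f ‖v x‖ * ‖g x‖) + 0 * ∫ x in a..b, ‖g x‖)) :=
    ((continuous_const.add (continuous_id.mul continuous_const)).tendsto 0).mono_left
      nhdsWithin_le_nhds
  rw [zero_mul, add_zero] at hlim
  exact ge_of_tendsto hlim (eventually_mem_nhdsWithin.mono hη)

/-- The energy density. -/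
noncomputable def energyDensity (f : ℝ → ℝ) (v g : ℝ → ℂ) (x : ℝ) : ℝ≥0∞ :=
  1 / 2 * ENNReal.ofReal (‖g x‖ ^ 2) + 1 / 2 * ENNReal.ofReal (potential f (‖v x‖ ^ 2))

theorem energy_eq_lintegral {f : ℝ → ℝ} (hf : Continuous f) {v : ℝ → ℂ} (hv : Continuous v) :
    energy f v = ∫⁻ x, energyDensity f v (weakDeriv v) x := by
  have hm : Measurable fun x => ENNReal.ofReal (potential f (‖v x‖ ^ 2)) :=
    ((continuous_potential hf).comp (hv.norm.pow 2)).measurable.ennreal_ofReal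
  unfold energyDensity
  -- Additivity needs measurability of one summand only, here the continuous potential term, and a
  -- finite constant factors out of the other without it.
  rw [lintegral_add_right _ (hm.const_mul _), lintegral_const_mul' _ _ (by simp),
    lintegral_const_mul _ hm, energy]

/-- Young's inequality `ab ≤ ½a² + ½b²` with `a = √F(|v|²)` and `b = |g|`. -/
theorem ofReal_abs_action_sub_le {f : ℝ → ℝ} (hf : Continuous f) (hF : Coercive f) {v g : ℝ → ℂ}
    (hv : Continuous v) (h : HasWeakDeriv v g) {a b : ℝ} (hab : a ≤ b) :
    ENNReal.ofReal |action f ‖v b‖ - action f ‖v a‖| ≤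
      ∫⁻ x in Set.Ioc a b, energyDensity f v g x := by
  have hint : IntegrableOn (fun x => speed f ‖v x‖ * ‖g x‖) (Set.Ioc a b) := by
    refine (IntegrableOn.continuousOn_mul ((continuous_speed hf).comp hv.norm).continuousOn
      (h.2.1.integrableOn_isCompact isCompact_Icc).norm isCompact_Icc).mono_set
      Set.Ioc_subset_Icc_self
  refine (ENNReal.ofReal_le_ofReal (abs_action_sub_le hf hv h hab)).trans ?_
  rw [intervalIntegral.integral_of_le hab, ofReal_integral_eq_lintegral_ofReal hint
    (Eventually.of_forall fun x => mul_nonneg (speed_nonneg _ _) (norm_nonneg _))]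
  refine lintegral_mono fun x => ?_
  have h2 : (1 / 2 : ℝ≥0∞) = ENNReal.ofReal (1 / 2) := by
    rw [ENNReal.ofReal_div_of_pos two_pos]; simp
  have hP := hF.potential_nonneg (sq_nonneg ‖v x‖)
  rw [energyDensity, h2, ← ENNReal.ofReal_mul (by norm_num), ← ENNReal.ofReal_mul (by norm_num),
    ← ENNReal.ofReal_add (by positivity) (by positivity), ← hF.sq_speed]
  refine ENNReal.ofReal_le_ofReal ?_
  nlinarith [sq_nonneg (speed f ‖v x‖ - ‖g x‖)]

/-- A function of finite energy has modulus close to `1` somewhere on each set of infinite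
measure. -/
theorem exists_one_sub_lt_norm {f : ℝ → ℝ} (hF : Coercive f) {v : ℝ → ℂ} (hE : energy f v < ⊤)
    {s : Set ℝ} (hs : MeasurableSet s) (hvol : volume s = ⊤) {ε : ℝ} (h0 : 0 < ε) (h1 : ε < 1) :
    ∃ x ∈ s, 1 - ε < ‖v x‖ := by
  by_contra! hle
  obtain ⟨l, hl, hlF⟩ := hF
  have hP : ∀ x ∈ s, ENNReal.ofReal (l * ε ^ 2) ≤ ENNReal.ofReal (potential f (‖v x‖ ^ 2)) := by
    intro x hx
    refine ENNReal.ofReal_le_ofReal (le_trans ?_ (hlF _ (sq_nonneg _)))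
    have h2 := hle x hx
    have h3 := norm_nonneg (v x)
    -- `1 - (1 - ε)² = 2ε - ε² ≥ ε`, as `ε < 1`.
    have h4 : ε ≤ 1 - ‖v x‖ ^ 2 := by nlinarith
    exact mul_le_mul_of_nonneg_left (pow_le_pow_left₀ h0.le h4 2) hl.le
  have htop : ∫⁻ x, ENNReal.ofReal (potential f (‖v x‖ ^ 2)) = ⊤ := by
    refine top_le_iff.1 ((?_ : _ ≤ _).trans (setLIntegral_le_lintegral s _))
    calc ⊤ = ENNReal.ofReal (l * ε ^ 2) * volume s := by
          rw [hvol, ENNReal.mul_top]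
          exact (ENNReal.ofReal_pos.2 (by positivity)).ne'
      _ = ∫⁻ _ in s, ENNReal.ofReal (l * ε ^ 2) := by simp
      _ ≤ _ := setLIntegral_mono' hs hP
  rw [energy, htop] at hE
  simp [ENNReal.mul_top] at hE

/-- A function whose modulus has infimum zero has at least the energy of a kink. -/
theorem ofReal_le_energy {f : ℝ → ℝ} (hf : Continuous f) (hF : Coercive f) {v : ℝ → ℂ}
    (hv : MemH1loc v) (hinf : (⨅ x, ‖v x‖) = 0) :
    ENNReal.ofReal (2 * action f 1) ≤ energy f v := by
  rcases eq_top_or_lt_top (energy f v) with hE | hE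
  · simp [hE]
  obtain ⟨hvc, -, g, hg, -⟩ := hv
  have hw := hasWeakDeriv_weakDeriv hg
  -- The margin `ε` is needed because `|v|` may neither attain its infimum nor reach 1; both
  -- half-lines around a point with `|v| < ε` contribute.
  have key : ∀ ε ∈ Set.Ioo (0 : ℝ) 1,
      ENNReal.ofReal (2 * (action f (1 - ε) - action f ε)) ≤ energy f v := by
    rintro ε ⟨h0, h1⟩
    obtain ⟨x, hx⟩ : ∃ x, ‖v x‖ < ε := exists_lt_of_ciInf_lt (by rwa [hinf])
    obtain ⟨b, hxb, hb⟩ := exists_one_sub_lt_norm hF hE (measurableSet_Ici (a := x))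
      Real.volume_Ici h0 h1
    obtain ⟨a, hax, ha⟩ := exists_one_sub_lt_norm hF hE (measurableSet_Iic (a := x))
      Real.volume_Iic h0 h1
    have hmono := monotone_action hf
    have hle : ∀ y, 1 - ε < ‖v y‖ → action f (1 - ε) - action f ε ≤
        action f ‖v y‖ - action f ‖v x‖ := fun y hy => sub_le_sub (hmono hy.le) (hmono hx.le)
    rw [energy_eq_lintegral hf hvc, two_mul]
    refine ENNReal.ofReal_add_le.trans ?_
    calc _ ≤ (∫⁻ t in Set.Ioc a x, energyDensity f v (weakDeriv v) t) +
          ∫⁻ t in Set.Ioc x b, energyDensity f v (weakDeriv v) t := by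
          refine add_le_add ((ENNReal.ofReal_le_ofReal ?_).trans
            (ofReal_abs_action_sub_le hf hF hvc hw hax)) ((ENNReal.ofReal_le_ofReal ?_).trans
            (ofReal_abs_action_sub_le hf hF hvc hw hxb))
          · rw [abs_sub_comm]
            exact (hle a ha).trans (le_abs_self _)
          · exact (hle b hb).trans (le_abs_self _)
      _ = ∫⁻ t in Set.Ioc a x ∪ Set.Ioc x b, energyDensity f v (weakDeriv v) t :=
          (lintegral_union measurableSet_Ioc (Set.Ioc_disjoint_Ioc_of_le le_rfl)).symm
      _ ≤ _ := setLIntegral_le_lintegral _ _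
  have hc := continuous_action hf
  have hlim : Tendsto (fun ε => ENNReal.ofReal (2 * (action f (1 - ε) - action f ε))) (𝓝[>] 0)
      (𝓝 (ENNReal.ofReal (2 * (action f (1 - 0) - action f 0)))) := by
    have : Continuous fun ε => ENNReal.ofReal (2 * (action f (1 - ε) - action f ε)) :=
      ENNReal.continuous_ofReal.comp (by fun_prop)
    exact (this.tendsto 0).mono_left nhdsWithin_le_nhds
  rw [sub_zero, action_zero, sub_zero] at hlim
  exact le_of_tendsto hlim (mem_of_superset (Ioo_mem_nhdsGT one_pos) key)

/-! ### The energy of kinks -/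

/-- Every kink has energy `2 ∫₀¹ √F(s²) ds`. -/
theorem energy_kink {f : ℝ → ℝ} (hf : ContDiff ℝ 1 f) (hF : Coercive f) {u : ℝ → ℂ}
    (hu : IsKink f u) : energy f u = ENNReal.ofReal (2 * action f 1) := by
  obtain ⟨u', hu1, hu2⟩ := (isTravellingWave_zero_iff hf.continuous).1 hu.1
  have hfi := (kink_first_integrals hf hF hu1 hu2 hu.2.2).1
  have cu : Continuous u := continuous_iff_continuousAt.2 fun x => (hu1 x).continuousAt
  have cu' : Continuous u' := continuous_iff_continuousAt.2 fun x => (hu2 x).continuousAt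
  obtain ⟨w, hw, hw1, htop, hbot⟩ := exists_real_kink hf hF
  obtain ⟨θ, a, h⟩ := kink_unique hf hF (isKink_ofReal hf hF hw hw1 htop hbot) hu
  have hn : ∀ x, ‖u x‖ ^ 2 = w (x + a) ^ 2 := fun x => by
    rw [h x, norm_mul, mul_comm Complex.I, Complex.norm_exp_ofReal_mul_I, one_mul,
      Complex.norm_real, Real.norm_eq_abs, sq_abs]
  have hP : ∫⁻ x, ENNReal.ofReal (potential f (‖u x‖ ^ 2)) = ENNReal.ofReal (2 * action f 1) := by
    simp_rw [hn]
    rw [lintegral_add_right_eq_self (fun x => ENNReal.ofReal (potential f (w x ^ 2))) a,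
      lintegral_potential_real_kink hf hF hw htop hbot]
  -- Equipartition `|u'|² = F(|u|²)` makes the kinetic integral equal to the potential one.
  have hK : ∫⁻ x, ENNReal.ofReal (‖weakDeriv u x‖ ^ 2) = ENNReal.ofReal (2 * action f 1) := by
    rw [← hP]
    refine lintegral_congr_ae ((weakDeriv_ae_eq_of_hasDerivAt hu1 cu').mono fun x hx => ?_)
    simp only [hx, hfi]
  rw [energy, hP, hK, ← add_mul, ENNReal.add_halves, one_mul]

end NLSKink

/-! ### The main theorem -/

theorem mainTheorem6 (f : ℝ → ℝ) (hf : ContDiff ℝ 1 f)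
    (hF : ∃ l : ℝ, 0 < l ∧ ∀ ρ : ℝ, 0 ≤ ρ → l * (1 - ρ) ^ 2 ≤ NLSKink.potential f ρ) :
    (∃ v₀ : ℝ → ℂ, NLSKink.IsKink f v₀) ∧
    (∀ v₀ w : ℝ → ℂ, NLSKink.IsKink f v₀ → NLSKink.IsKink f w →
      ∃ θ a : ℝ, ∀ x, w x = Complex.exp (Complex.I * θ) * v₀ (x + a)) ∧
    (∀ v₀ : ℝ → ℂ, NLSKink.IsKink f v₀ →
      NLSKink.MemH1loc v₀ ∧ (∃ x, v₀ x = 0) ∧ NLSKink.energy f v₀ < ⊤ ∧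
      NLSKink.energy f v₀ =
        sInf {e | ∃ v : ℝ → ℂ, NLSKink.MemH1loc v ∧ (⨅ x, ‖v x‖) = 0 ∧ e = NLSKink.energy f v} ∧
      (∀ v : ℝ → ℂ, NLSKink.MemH1loc v → (∃ x, v x = 0) →
        NLSKink.energy f v₀ ≤ NLSKink.energy f v) ∧
      (∀ v : ℝ → ℂ, NLSKink.MemH1loc v → NLSKink.energy f v < NLSKink.energy f v₀ →
        0 < ⨅ x, ‖v x‖)) := by
  have hC : NLSKink.Coercive f := hF
  obtain ⟨w, hw, hw1, htop, hbot⟩ := NLSKink.exists_real_kink hf hC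
  refine ⟨⟨_, NLSKink.isKink_ofReal hf hC hw hw1 htop hbot⟩,
    fun v₀ w hv hw => NLSKink.kink_unique hf hC hv hw, fun v₀ hv₀ => ?_⟩
  obtain ⟨u', hu1, hu2⟩ := (NLSKink.isTravellingWave_zero_iff hf.continuous).1 hv₀.1
  have hH1 : NLSKink.MemH1loc v₀ := NLSKink.memH1loc_of_hasDerivAt hu1
    (continuous_iff_continuousAt.2 fun x => (hu2 x).continuousAt)
  have hzero := NLSKink.kink_exists_zero hf hC hu1 hu2 hv₀.2.2 hv₀.2.1
  have hinf : ∀ v : ℝ → ℂ, (∃ x, v x = 0) → (⨅ x, ‖v x‖) = 0 := by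
    rintro v ⟨x, hx⟩
    refine le_antisymm ?_ (Real.iInf_nonneg fun x => norm_nonneg _)
    exact (ciInf_le ⟨0, by rintro _ ⟨y, rfl⟩; exact norm_nonneg _⟩ x).trans (by simp [hx])
  have hE := NLSKink.energy_kink hf hC hv₀
  have hmin : ∀ v : ℝ → ℂ, NLSKink.MemH1loc v → (⨅ x, ‖v x‖) = 0 →
      NLSKink.energy f v₀ ≤ NLSKink.energy f v := fun v hv h => by
    rw [hE]
    exact NLSKink.ofReal_le_energy hf.continuous hC hv h
  refine ⟨hH1, hzero, by rw [hE]; exact ENNReal.ofReal_lt_top, le_antisymm ?_ ?_,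
    fun v hv h => hmin v hv (hinf v h), fun v hv h => ?_⟩
  · refine le_sInf ?_
    rintro _ ⟨v, hv, h, rfl⟩
    exact hmin v hv h
  · exact sInf_le ⟨v₀, hH1, hinf v₀ hzero, rfl⟩
  · refine lt_of_le_of_ne (Real.iInf_nonneg fun x => norm_nonneg _) fun h0 => ?_
    exact absurd (hmin v hv h0.symm) (not_le.2 h)
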